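/- Let $k\ge 3$ be an integer and let $D$ be a strong digraph, i.e. a digraph such that for any two vertices $x,y$ there is a directed path from $x$ to $y$. Let $\chi(D)$ be the chromatic number of the underlying undirected graph of $D$ (the least number of colours in a colouring of the vertices in which adjacent vertices get different colours). If $\chi(D) > (2k-2)(2k-3)$, then $D$ contains a subdivision of $B(k,1;1)$. Here $B(k,1;1)$ is the digraph formed by two distinct vertices $x,y$ and three pairwise internally disjoint directed paths: one from $x$ to $y$ of length $k$, another one from $x$ to $y$ of length $1$, and one from $y$ to $x$ of length $1$; a subdivision of a digraph $F$ is obtained by replacing the arcs $uv$ of $F$ by pairwise internally disjoint directed paths from $u$ to $v$ of length at least $1$, whose internal vertices are not vertices of $F$. In other words, $D$ contains two vertices $x\ne y$ and three pairwise internally disjoint directed paths: two distinct ones from $x$ to $y$, one of which has length at least $k$, and one from $y$ to $x$. -/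

import Mathlib

namespace Digraph

/-- The chromatic number of a digraph is that of its underlying graph (an element of `ℕ∞`). -/
noncomputable def chromaticNumber {V : Type*} (D : Digraph V) : ℕ∞ :=
  D.toSimpleGraphInclusive.chromaticNumber

/-- `D` is strong: for any two vertices `x, y` there is a directed path from `x` to `y`
(equivalently, a directed walk, that is, a finite succession of arcs). -/
def IsStrong {V : Type*} (D : Digraph V) : Prop :=
  ∀ x y : V, Relation.ReflTransGen D.Adj x y

/-- A subdivision of `F` inside `D`: the vertices of `F` are mapped injectively to vertices of `D`,
and each arc `u v` of `F` is replaced by the directed path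
`branch u, inner u v, branch v` of `D`, whose list of internal vertices `inner u v` may be empty.
Internal vertices are not branch vertices, and the paths of distinct arcs share no internal vertex.
The values of `inner` at pairs that are not arcs of `F` play no role. -/
structure SubdivisionIn {W V : Type*} (F : Digraph W) (D : Digraph V) where
  branch : W → V
  branch_injective : Function.Injective branch
  inner : W → W → List V
  isChain : ∀ u v, F.Adj u v → (branch u :: (inner u v ++ [branch v])).IsChain D.Adj
  nodup : ∀ u v, F.Adj u v → (inner u v).Nodup
  branch_notMem : ∀ u v w, F.Adj u v → branch w ∉ inner u v
  disjoint : ∀ u v u' v', F.Adj u v → F.Adj u' v' → (u, v) ≠ (u', v') →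
    List.Disjoint (inner u v) (inner u' v')

/-- `D` contains (as a subdigraph) a subdivision of `F`. -/
def ContainsSubdivision {W V : Type*} (D : Digraph V) (F : Digraph W) : Prop :=
  Nonempty (SubdivisionIn F D)

/-- The digraph `B(k,1;1)` (for `k ≥ 2`): with `x = 0` and `y = k` it is the union of the directed
`(x,y)`-path `0 → 1 → ⋯ → k` of length `k`, the directed `(x,y)`-path of length `1` given by the arc
`0 → k`, and the directed `(y,x)`-path of length `1` given by the arc `k → 0`.
The subdivisions of this digraph are precisely the unions of two directed `(x,y)`-paths of lengths
at least `k` and at least `1` and a directed `(y,x)`-path of length at least `1`, where `x ≠ y`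
and the three paths are pairwise internally disjoint and arc-disjoint. -/
def bispindle (k : ℕ) : Digraph (Fin (k + 1)) where
  Adj i j := (i : ℕ) + 1 = j ∨ ((i : ℕ) = 0 ∧ (j : ℕ) = k) ∨ ((i : ℕ) = k ∧ (j : ℕ) = 0)

end Digraph

/-! Suppose that there is no spindle. By compactness it suffices to colour finite strong
subdigraphs, and there the colouring is a product: the vertices are partitioned into classes, each
coloured with `2k - 2` colours, and the quotient is coloured with `2k - 3`.

The classes are `Good` sets, which abstract three properties of a cycle of length at least `2k - 2`.
It is strong. A path outside it between two of its vertices (an ear) has length less than `k`, and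
the cycle contains a return path of length at least `k - 1`; otherwise ear and cycle would form a
spindle. It is `(2k - 2)`-colourable, because its chords span fewer than `k` arcs. Good sets sharing
exactly one vertex have a good union (`Good.union`): a path from one to the other outside both, with
ends other than the common vertex, combines with a long return path into an ear of length at least
`k`.

Take a partition into good sets with the fewest classes. A quotient cycle of length at least `2k -
2` lifts to a cycle meeting each of its classes once, since ears are short (`exists_lift_cycle`).
That cycle is good, and gluing these classes to it gives a coarser partition, a contradiction. So
quotient cycles have length at most `2k - 3`, and Bondy's theorem
(`exists_coloring_of_forall_cycle_le`) colours the strong quotient. -/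

namespace Dipath

/-! ### Walks, paths, cycles and spindles. -/

variable {α : Type*}

/-- `IsWalk r x l y`: the vertices `x`, the members of `l` and `y`, in this order, form a walk of
the relation `r`. -/
def IsWalk (r : α → α → Prop) : α → List α → α → Prop
  | x, [], y => r x y
  | x, m :: l, y => r x m ∧ IsWalk r m l y

/-- `IsPath r x l y`: a walk from `x` to `y` with list of internal vertices `l`, without repetitions
except that `x = y` is allowed (the path is then a directed cycle). -/
structure IsPath (r : α → α → Prop) (x : α) (l : List α) (y : α) : Prop where
  walk : IsWalk r x l y
  nodup : l.Nodup
  left_notMem : x ∉ l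
  right_notMem : y ∉ l

variable {r : α → α → Prop} {x y z : α} {l : List α}

@[simp] theorem isWalk_nil : IsWalk r x [] y ↔ r x y := Iff.rfl

@[simp] theorem isWalk_cons {m : α} : IsWalk r x (m :: l) y ↔ r x m ∧ IsWalk r m l y := Iff.rfl

@[simp] theorem isWalk_append_cons {A B : List α} {m : α} :
    IsWalk r x (A ++ m :: B) y ↔ IsWalk r x A m ∧ IsWalk r m B y := by
  induction A generalizing x with
  | nil => simp
  | cons a A ih => simp [ih, and_assoc]

theorem IsWalk.isChain (h : IsWalk r x l y) : (x :: (l ++ [y])).IsChain r := by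
  induction l generalizing x with
  | nil => simpa using h
  | cons a A ih => simpa using ⟨h.1, ih h.2⟩

theorem IsWalk.map {β : Type*} {r' : β → β → Prop} {f : α → β}
    (hr : ∀ a b, r a b → r' (f a) (f b)) (h : IsWalk r x l y) :
    IsWalk r' (f x) (l.map f) (f y) := by
  induction l generalizing x with
  | nil => exact hr _ _ h
  | cons a A ih => exact ⟨hr _ _ h.1, ih h.2⟩

theorem IsPath.map {β : Type*} {r' : β → β → Prop} {f : α → β} (hf : Function.Injective f)
    (hr : ∀ a b, r a b → r' (f a) (f b)) (h : IsPath r x l y) :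
    IsPath r' (f x) (l.map f) (f y) :=
  ⟨h.walk.map hr, h.nodup.map hf, by simpa [hf.eq_iff] using h.left_notMem,
    by simpa [hf.eq_iff] using h.right_notMem⟩

theorem isPath_of_rel (h : r x y) : IsPath r x [] y := ⟨h, by simp, by simp, by simp⟩

theorem exists_isPath_of_reflTransGen (h : Relation.ReflTransGen r x y) (hxy : x ≠ y) :
    ∃ l, IsPath r x l y := by
  induction h using Relation.ReflTransGen.head_induction_on with
  | refl => exact absurd rfl hxy
  | @head a c hac _ ih =>
    by_cases hc : c = y
    · subst hc; exact ⟨[], isPath_of_rel hac⟩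
    · obtain ⟨l, hl⟩ := ih hc
      -- If `a` already occurs on the path, keep only the part starting there.
      by_cases ha : a ∈ c :: l
      · rcases List.mem_cons.1 ha with rfl | ha
        · exact ⟨l, hl⟩
        · obtain ⟨A, B, rfl⟩ := List.append_of_mem ha
          obtain ⟨h1, h2, h3, h4⟩ := hl
          refine ⟨B, (isWalk_append_cons.1 h1).2, ?_, ?_, ?_⟩ <;> grind
      · refine ⟨c :: l, ⟨hac, hl.walk⟩, ?_, ha, ?_⟩
        · have := hl.nodup; have := hl.left_notMem; grind
        · have := hl.right_notMem; grind

/-- There is a path between any two vertices of `S` within `S`. -/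
def StrongOn (r : α → α → Prop) (S : Set α) : Prop :=
  ∀ x ∈ S, ∀ y ∈ S, x ≠ y → ∃ l, IsPath r x l y ∧ ∀ z ∈ l, z ∈ S

/-- Concatenation of paths whose vertex sets are disjoint. -/
theorem IsPath.append {m : α} {A B : List α} (hA : IsPath r x A m) (hB : IsPath r m B y)
    (hx : x ∉ B) (hy : y ∉ A) (hxm : x ≠ m) (hym : y ≠ m) (hAB : A.Disjoint B) :
    IsPath r x (A ++ m :: B) y := by
  obtain ⟨a1, a2, a3, a4⟩ := hA
  obtain ⟨b1, b2, b3, b4⟩ := hB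
  refine ⟨isWalk_append_cons.2 ⟨a1, b1⟩, ?_, ?_, ?_⟩
  · rw [List.nodup_append, List.nodup_cons]
    refine ⟨a2, ⟨b3, b2⟩, ?_⟩
    intro a ha b hb e
    subst e
    rcases List.mem_cons.1 hb with rfl | hb
    · exact a4 ha
    · exact hAB ha hb
  · grind
  · grind

/-- A cycle, seen from one of its vertices. -/
theorem IsPath.rotate {m : α} {A B : List α} (h : IsPath r x (A ++ m :: B) x) :
    IsPath r m (B ++ x :: A) m := by
  obtain ⟨a1, a2, a3, a4⟩ := h
  have := isWalk_append_cons.1 a1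
  refine ⟨isWalk_append_cons.2 ⟨this.2, this.1⟩, ?_, ?_, ?_⟩ <;> grind

/-- A cycle through two vertices consists of two paths. -/
theorem IsPath.exists_split {u w : α} (h : IsPath r x l x) (hu : u ∈ x :: l) (hw : w ∈ x :: l)
    (huw : u ≠ w) : ∃ A B, IsPath r u (A ++ w :: B) u ∧ (x :: l).Perm (u :: (A ++ w :: B)) := by
  have key : ∃ l', IsPath r u l' u ∧ (x :: l).Perm (u :: l') := by
    rcases List.mem_cons.1 hu with rfl | hu
    · exact ⟨l, h, List.Perm.refl _⟩
    · obtain ⟨A, B, rfl⟩ := List.append_of_mem hu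
      refine ⟨_, h.rotate, ?_⟩
      rw [← List.cons_append, ← List.cons_append]
      exact List.perm_append_comm
  obtain ⟨l', h', hp⟩ := key
  have : w ∈ l' := by
    have := hp.mem_iff.1 hw
    grind
  obtain ⟨A, B, rfl⟩ := List.append_of_mem this
  exact ⟨A, B, h', hp⟩

theorem IsPath.left {m : α} {A B : List α} (h : IsPath r x (A ++ m :: B) y) : IsPath r x A m := by
  obtain ⟨a1, a2, a3, a4⟩ := h
  refine ⟨(isWalk_append_cons.1 a1).1, ?_, ?_, ?_⟩ <;> grind

theorem IsPath.right {m : α} {A B : List α} (h : IsPath r x (A ++ m :: B) y) : IsPath r m B y := by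
  obtain ⟨a1, a2, a3, a4⟩ := h
  refine ⟨(isWalk_append_cons.1 a1).2, ?_, ?_, ?_⟩ <;> grind

/-- Two `(x,y)`-paths, one of which has length at least `k`, and a `(y,x)`-path, pairwise
internally disjoint. -/
structure IsSpindle (r : α → α → Prop) (k : ℕ) (x y : α) (P Q R : List α) : Prop where
  ne : x ≠ y
  long : IsPath r x P y
  short : IsPath r x Q y
  back : IsPath r y R x
  le_length : k ≤ P.length + 1
  disjoint_long_short : P.Disjoint Q
  disjoint_long_back : P.Disjoint R
  disjoint_short_back : Q.Disjoint R

/-- No two `(x,y)`-paths and `(y,x)`-path as in `IsSpindle` exist. -/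
def SpindleFree (r : α → α → Prop) (k : ℕ) : Prop := ∀ x y P Q R, ¬ IsSpindle r k x y P Q R

theorem IsSpindle.map {β : Type*} {r' : β → β → Prop} {f : α → β} (hf : Function.Injective f)
    (hr : ∀ a b, r a b → r' (f a) (f b)) {k : ℕ} {P Q R : List α} (h : IsSpindle r k x y P Q R) :
    IsSpindle r' k (f x) (f y) (P.map f) (Q.map f) (R.map f) where
  ne := hf.ne h.ne
  long := h.long.map hf hr
  short := h.short.map hf hr
  back := h.back.map hf hr
  le_length := by simpa using h.le_length
  disjoint_long_short := List.disjoint_map hf h.disjoint_long_short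
  disjoint_long_back := List.disjoint_map hf h.disjoint_long_back
  disjoint_short_back := List.disjoint_map hf h.disjoint_short_back

end Dipath

/-! ### From spindles to subdivisions of `B(k,1;1)`. -/

namespace Dipath

variable {α : Type*} {r : α → α → Prop} {x y : α}

/-- A spindle with long path `P` splits this path after `k - 1` arcs, so that its first vertices are
the branch vertices of a subdivision of `B(k,1;1)`. -/
theorem IsSpindle.containsSubdivision {D : Digraph α} {k : ℕ} (hk : 3 ≤ k) {P Q R : List α}
    (h : IsSpindle D.Adj k x y P Q R) : D.ContainsSubdivision (Digraph.bispindle k) := by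
  -- `x`, the `k - 2` vertices of `P₁`, `p` and `y` are the `k + 1` branch vertices; on the long
  -- path only the last arc is subdivided, by `P₂`.
  obtain ⟨P₁, p, P₂, rfl, hlen⟩ : ∃ P₁ p P₂, P = P₁ ++ p :: P₂ ∧ P₁.length = k - 2 := by
    have hl := h.le_length
    refine ⟨P.take (k - 2), P[k - 2], P.drop (k - 1), ?_, ?_⟩
    · have : k - 1 = k - 2 + 1 := by omega
      rw [this, ← List.drop_eq_getElem_cons, List.take_append_drop]
    · rw [List.length_take]; omega
  obtain ⟨hxy, ⟨wP, nP, xP, yP⟩, ⟨wQ, nQ, xQ, yQ⟩, ⟨wR, nR, yR, xR⟩, -, hPQ, hPR, hQR⟩ := h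
  rw [isWalk_append_cons] at wP
  set L : List α := x :: (P₁ ++ [p, y]) with hL
  have hLlen : L.length = k + 1 := by simp [hL, hlen]; omega
  have hLnodup : L.Nodup := by grind
  have hget : ∀ i : Fin (k + 1), (i : ℕ) < L.length := fun i => by rw [hLlen]; exact i.2
  have hmem : ∀ i : Fin (k + 1), L[(i : ℕ)]'(hget i) ∈ L := fun i => List.getElem_mem _
  have hP₂ : ∀ a ∈ L, a ∉ P₂ := by grind
  have hQ : ∀ a ∈ L, a ∉ Q := by
    intro a ha haQ
    have := @hPQ a
    grind
  have hR : ∀ a ∈ L, a ∉ R := by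
    intro a ha haR
    have := @hPR a
    grind
  have hP₂Q : P₂.Disjoint Q := fun a ha hb => hPQ (by simp [ha]) hb
  have hP₂R : P₂.Disjoint R := fun a ha hb => hPR (by simp [ha]) hb
  have h0 : ∀ i : Fin (k + 1), (i : ℕ) = 0 → L[(i : ℕ)]'(hget i) = x := by
    intro i hi; simp [hL, hi]
  have hkk : ∀ i : Fin (k + 1), (i : ℕ) = k → L[(i : ℕ)]'(hget i) = y := by
    intro i hi; grind
  have hpp : ∀ i : Fin (k + 1), (i : ℕ) + 1 = k → L[(i : ℕ)]'(hget i) = p := by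
    intro i hi; grind
  have hstep : ∀ i j : Fin (k + 1), (i : ℕ) + 1 = j → (j : ℕ) ≠ k →
      D.Adj (L[(i : ℕ)]'(hget i)) (L[(j : ℕ)]'(hget j)) := by
    intro i j hij hj
    have hc := wP.1.isChain
    rw [List.isChain_iff_getElem] at hc
    have hjk : (j : ℕ) < k := by have := j.2; omega
    have hl' : (x :: (P₁ ++ [p])).length = k := by simp [hlen]; omega
    have e : L = (x :: (P₁ ++ [p])) ++ [y] := by simp [hL]
    have := hc i (by rw [hl']; omega)
    simp only [e]
    rw [List.getElem_append_left (by rw [hl']; omega), List.getElem_append_left (by rw [hl']; omega)]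
    simpa only [hij] using this
  let inner : Fin (k + 1) → Fin (k + 1) → List α := fun u v =>
    if (u : ℕ) = 0 ∧ (v : ℕ) = k then Q else if (u : ℕ) = k then R
    else if (v : ℕ) = k then P₂ else []
  have cases : ∀ u v : Fin (k + 1), (Digraph.bispindle k).Adj u v →
      ((u : ℕ) = 0 ∧ (v : ℕ) = k ∧ inner u v = Q) ∨ ((u : ℕ) = k ∧ (v : ℕ) = 0 ∧ inner u v = R) ∨
      ((u : ℕ) + 1 = k ∧ (v : ℕ) = k ∧ inner u v = P₂) ∨
      ((u : ℕ) + 1 = v ∧ (v : ℕ) ≠ k ∧ inner u v = []) := by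
    intro u v huv
    have hu := u.2
    have hv := v.2
    simp only [Digraph.bispindle] at huv
    simp only [inner]
    rcases huv with huv | huv | huv
    · by_cases hvk : (v : ℕ) = k
      · right; right; left
        refine ⟨by omega, hvk, ?_⟩
        rw [if_neg (by omega), if_neg (by omega), if_pos hvk]
      · right; right; right
        refine ⟨huv, hvk, ?_⟩
        rw [if_neg (by omega), if_neg (by omega), if_neg hvk]
    · left; exact ⟨huv.1, huv.2, if_pos huv⟩
    · right; left
      refine ⟨huv.1, huv.2, ?_⟩
      rw [if_neg (by omega), if_pos huv.1]
  refine ⟨⟨fun i => L[(i : ℕ)]'(hget i), ?_, inner, ?_, ?_, ?_, ?_⟩⟩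
  · intro i j hij
    exact Fin.ext ((hLnodup.getElem_inj_iff).1 hij)
  · intro u v huv
    rcases cases u v huv with ⟨h1, h2, h3⟩ | ⟨h1, h2, h3⟩ | ⟨h1, h2, h3⟩ | ⟨h1, h2, h3⟩
    · rw [h3, h0 u h1, hkk v h2]; exact wQ.isChain
    · rw [h3, h0 v h2, hkk u h1]; exact wR.isChain
    · rw [h3, hpp u h1, hkk v h2]; exact wP.2.isChain
    · rw [h3]; simpa using hstep u v h1 h2
  · intro u v huv
    rcases cases u v huv with ⟨-, -, h3⟩ | ⟨-, -, h3⟩ | ⟨-, -, h3⟩ | ⟨-, -, h3⟩ <;> rw [h3]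
    · exact nQ
    · exact nR
    · grind
    · simp
  · intro u v w huv
    rcases cases u v huv with ⟨-, -, h3⟩ | ⟨-, -, h3⟩ | ⟨-, -, h3⟩ | ⟨-, -, h3⟩ <;> rw [h3]
    · exact hQ _ (hmem w)
    · exact hR _ (hmem w)
    · exact hP₂ _ (hmem w)
    · simp
  · intro u v u' v' huv huv' hne
    have hne' : ¬ ((u : ℕ) = u' ∧ (v : ℕ) = v') := fun h => hne (by
      rw [Prod.mk.injEq]; exact ⟨Fin.ext h.1, Fin.ext h.2⟩)
    rcases cases u v huv with ⟨h1, h2, h3⟩ | ⟨h1, h2, h3⟩ | ⟨h1, h2, h3⟩ | ⟨h1, h2, h3⟩ <;>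
    rcases cases u' v' huv' with
      ⟨h1', h2', h3'⟩ | ⟨h1', h2', h3'⟩ | ⟨h1', h2', h3'⟩ | ⟨h1', h2', h3'⟩ <;>
    rw [h3, h3'] <;>
    first
    | exact List.disjoint_nil_right _
    | exact List.disjoint_nil_left _
    | assumption
    | (apply List.Disjoint.symm; assumption)
    | (exfalso; omega)

end Dipath

/-! ### Arc weights, potentials and Bondy's theorem. -/

namespace Dipath

variable {α : Type*} {r : α → α → Prop} {x y z : α} {l : List α}

/-- The sum of the weights of the arcs of a walk. -/
def walkWeight (w : α → α → ℤ) : α → List α → α → ℤ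
  | x, [], y => w x y
  | x, m :: l, y => w x m + walkWeight w m l y

variable {w : α → α → ℤ}

@[simp] theorem walkWeight_nil : walkWeight w x [] y = w x y := rfl

@[simp] theorem walkWeight_cons {m : α} :
    walkWeight w x (m :: l) y = w x m + walkWeight w m l y := rfl

@[simp] theorem walkWeight_append_cons {A B : List α} {m : α} :
    walkWeight w x (A ++ m :: B) y = walkWeight w x A m + walkWeight w m B y := by
  induction A generalizing x with
  | nil => simp
  | cons a A ih => simp [ih, add_assoc]

theorem walkWeight_mono {w' : α → α → ℤ} (h : ∀ a b, w a b ≤ w' a b) :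
    walkWeight w x l y ≤ walkWeight w' x l y := by
  induction l generalizing x with
  | nil => exact h _ _
  | cons a A ih => exact add_le_add (h _ _) ih

theorem walkWeight_one_sub_mul (s : ℤ) :
    walkWeight (fun a b => 1 - s * w a b) x l y = (l.length + 1) - s * walkWeight w x l y := by
  induction l generalizing x with
  | nil => simp
  | cons a A ih => simp only [walkWeight_cons, ih, List.length_cons]; push_cast; ring

/-- The weight `w`, lowered by one on the arc `(u, v)`. -/
def lower [DecidableEq α] (w : α → α → ℤ) (u v : α) : α → α → ℤ :=
  fun a b => if a = u ∧ b = v then w a b - 1 else w a b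

/-- A walk avoiding the arc `(u, v)` keeps its weight. -/
theorem walkWeight_lower_of_left_notMem [DecidableEq α] {u v : α} (hx : x ≠ u) (hl : u ∉ l) :
    walkWeight (lower w u v) x l y = walkWeight w x l y := by
  induction l generalizing x with
  | nil => simp [lower, hx]
  | cons a A ih =>
    rw [List.mem_cons, not_or] at hl
    rw [walkWeight_cons, walkWeight_cons, ih (Ne.symm hl.1) hl.2]
    simp [lower, hx]

theorem walkWeight_lower_of_right_notMem [DecidableEq α] {u v : α} (hy : y ≠ v) (hl : v ∉ l) :
    walkWeight (lower w u v) x l y = walkWeight w x l y := by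
  induction l generalizing x with
  | nil => simp [lower, hy]
  | cons a A ih =>
    rw [List.mem_cons, not_or] at hl
    rw [walkWeight_cons, walkWeight_cons, ih hl.2]
    simp [lower, Ne.symm hl.1]

theorem walkWeight_rotate {m : α} {A B : List α} :
    walkWeight w x (A ++ m :: B) x = walkWeight w m (B ++ x :: A) m := by
  simp only [walkWeight_append_cons]; ring

/-- Every directed cycle has weight at least one. -/
def CyclesPos (r : α → α → Prop) (w : α → α → ℤ) : Prop :=
  ∀ x l, IsPath r x l x → 1 ≤ walkWeight w x l x

/-- If lowering the weight of the arc `(u, v)` destroys positivity, then this arc lies on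
a cycle of weight one. -/
theorem CyclesPos.lower [DecidableEq α] (hw : CyclesPos r w) {u v : α} (huv : u ≠ v)
    (h : ∀ l, IsPath r v l u → r u v → w u v + walkWeight w v l u ≠ 1) :
    CyclesPos r (lower w u v) := by
  -- A cycle leaves `u` only once, so it loses at most one. Seen from `u`, the lowered arc can only
  -- be its first arc, and then its weight was at least two.
  have main : ∀ l, IsPath r u l u → 1 ≤ walkWeight (Dipath.lower w u v) u l u := by
    intro l hl
    cases l with
    | nil =>
      have := hw _ _ hl
      rw [walkWeight_lower_of_right_notMem huv (by simp)]
      exact this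
    | cons a A =>
      have h1 := hw _ _ hl
      rw [walkWeight_cons] at h1 ⊢
      have hA : IsPath r a A u := hl.right (A := [])
      have hua : u ∉ a :: A := hl.left_notMem
      rw [walkWeight_lower_of_left_notMem (by grind) (by grind)]
      by_cases hav : a = v
      · subst hav
        have := h A hA hl.walk.1
        simp only [Dipath.lower, and_self, if_true]
        omega
      · simpa [Dipath.lower, hav] using h1
  intro x l hl
  by_cases hx : u ∈ x :: l
  · rcases List.mem_cons.1 hx with rfl | hx
    · exact main l hl
    · obtain ⟨A, B, rfl⟩ := List.append_of_mem hx
      rw [walkWeight_rotate]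
      exact main _ hl.rotate
  · rw [List.mem_cons, not_or] at hx
    rw [walkWeight_lower_of_left_notMem (Ne.symm hx.1) hx.2]
    exact hw _ _ hl

/-- A strong finite relation carries an integer weight for which every cycle is positive
and every arc lies on a cycle of weight one. -/
theorem exists_weight [Finite α] (hr : StrongOn r Set.univ) :
    ∃ w : α → α → ℤ, CyclesPos r w ∧ ∀ u v, u ≠ v → r u v →
      ∃ l, IsPath r v l u ∧ w u v + walkWeight w v l u = 1 := by
  classical
  have := Fintype.ofFinite α
  have hret : ∀ p : α × α, ∃ l, p.1 ≠ p.2 → IsPath r p.2 l p.1 := by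
    intro p
    by_cases hp : p.1 = p.2
    · exact ⟨[], fun h => absurd hp h⟩
    · obtain ⟨l, hl, -⟩ := hr p.2 trivial p.1 trivial (Ne.symm hp)
      exact ⟨l, fun _ => hl⟩
  choose Z hZ using hret
  let E : Finset (α × α) := Finset.univ.filter fun p => p.1 ≠ p.2 ∧ r p.1 p.2
  -- The total weight of one fixed cycle through each arc. It is nonnegative for positive weights,
  -- so a minimiser exists; lowering an arc strictly lowers the term of its own cycle, so at a
  -- minimiser no arc can be lowered.
  let Φ : (α → α → ℤ) → ℤ := fun w => ∑ p ∈ E, (w p.1 p.2 + walkWeight w p.2 (Z p) p.1)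
  have hΦ : ∀ w, CyclesPos r w → 0 ≤ Φ w := by
    intro w hw
    refine Finset.sum_nonneg fun p hp => ?_
    obtain ⟨-, hp1, hp2⟩ := Finset.mem_filter.1 hp
    have hc := hZ p hp1
    have h1 := hw p.1 (p.2 :: Z p) ⟨⟨hp2, hc.walk⟩, List.nodup_cons.2 ⟨hc.left_notMem, hc.nodup⟩,
      by simpa [hp1] using hc.right_notMem, by simpa [hp1] using hc.right_notMem⟩
    rw [walkWeight_cons] at h1
    omega
  have hne : {w | CyclesPos r w}.Nonempty := by
    refine ⟨fun _ _ => 1, ?_⟩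
    have key : ∀ (l : List α) (x y : α), 1 ≤ walkWeight (fun _ _ => (1 : ℤ)) x l y := by
      intro l
      induction l with
      | nil => intro x y; simp
      | cons a A ih => intro x y; have := ih a y; rw [walkWeight_cons]; omega
    exact fun x l _ => key l x x
  obtain ⟨w, hw, hmin⟩ := (measure fun w => (Φ w).toNat).wf.has_min {w | CyclesPos r w} hne
  refine ⟨w, hw, fun u v huv hruv => ?_⟩
  by_contra! hcon
  have hw' := CyclesPos.lower hw huv fun l hl _ => hcon l hl
  apply hmin _ hw'
  have hle : ∀ a b, lower w u v a b ≤ w a b := by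
    intro a b; unfold lower; split_ifs <;> omega
  have hlt : Φ (lower w u v) < Φ w := by
    refine Finset.sum_lt_sum (fun p _ => add_le_add (hle _ _) (walkWeight_mono hle))
      ⟨(u, v), by simp [E, huv, hruv], add_lt_add_of_lt_of_le ?_ (walkWeight_mono hle)⟩
    simp [lower]
  have h0 := hΦ _ hw'
  change (Φ (lower w u v)).toNat < (Φ w).toNat
  omega

/-- If no cycle has positive weight, then longest paths define a potential. -/
theorem exists_potential [Finite α] {g : α → α → ℤ}
    (hg : ∀ x l, IsPath r x l x → walkWeight g x l x ≤ 0) :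
    ∃ θ : α → ℤ, ∀ u v, r u v → θ u + g u v ≤ θ v := by
  classical
  have := Fintype.ofFinite α
  -- The inserted `0` stands for the trivial path at `v`.
  let W : α → Set ℤ := fun v => insert 0 {n | ∃ x l, x ≠ v ∧ IsPath r x l v ∧ n = walkWeight g x l v}
  have hfin : ∀ v, (W v).Finite := by
    intro v
    refine Set.Finite.insert _ ?_
    have : {n | ∃ x l, x ≠ v ∧ IsPath r x l v ∧ n = walkWeight g x l v} ⊆
        (fun p : α × {l : List α // l.Nodup} => walkWeight g p.1 p.2.1 v) '' Set.univ := by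
      rintro n ⟨x, l, -, h, rfl⟩
      exact ⟨(x, ⟨l, h.nodup⟩), trivial, rfl⟩
    exact (Set.toFinite _).subset this
  have hmax : ∀ v, ∃ n ∈ W v, ∀ m ∈ W v, m ≤ n := fun v =>
    Set.exists_max_image (W v) id (hfin v) ⟨0, Set.mem_insert _ _⟩
  choose θ hθ hθmax using hmax
  refine ⟨θ, fun u v huv => ?_⟩
  by_cases hne : u = v
  · subst hne
    have := hg u [] (isPath_of_rel huv)
    rw [walkWeight_nil] at this
    omega
  rcases hθ u with h0 | ⟨x, l, hxu, hl, hn⟩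
  · rw [h0, zero_add]
    exact hθmax v _ (Or.inr ⟨u, [], hne, isPath_of_rel huv, rfl⟩)
  · rw [hn]
    -- If `v` is already on the path, the arc `u v` closes a cycle of nonpositive weight; dropping
    -- it leaves a path to `v`, possibly trivial, of at least the same weight.
    by_cases hv : v ∈ x :: l
    · rcases List.mem_cons.1 hv with rfl | hv
      · have hc : IsPath r v (l ++ [u]) v := by
          obtain ⟨a1, a2, a3, a4⟩ := hl
          refine ⟨isWalk_append_cons.2 ⟨a1, huv⟩, ?_, ?_, ?_⟩ <;> grind
        have h1 := hg _ _ hc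
        rw [walkWeight_append_cons, walkWeight_nil] at h1
        exact h1.trans (hθmax v 0 (Set.mem_insert _ _))
      · obtain ⟨A, B, rfl⟩ := List.append_of_mem hv
        have hc : IsPath r v (B ++ [u]) v := by
          obtain ⟨a1, a2, a3, a4⟩ := hl.right
          refine ⟨isWalk_append_cons.2 ⟨a1, huv⟩, ?_, ?_, ?_⟩ <;>
            (have := hl.nodup; grind)
        have h1 := hg _ _ hc
        have hxv : x ≠ v := by have := hl.left_notMem; grind
        have h2 := hθmax v _ (Or.inr ⟨x, A, hxv, hl.left, rfl⟩)
        rw [walkWeight_append_cons, walkWeight_nil] at h1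
        rw [walkWeight_append_cons]
        omega
    · have hxv : x ≠ v := by grind
      have hp : IsPath r x (l ++ [u]) v := by
        obtain ⟨a1, a2, a3, a4⟩ := hl
        refine ⟨isWalk_append_cons.2 ⟨a1, huv⟩, ?_, ?_, ?_⟩ <;> grind
      have h2 := hθmax v _ (Or.inr ⟨x, _, hxv, hp, rfl⟩)
      rw [walkWeight_append_cons, walkWeight_nil] at h2
      exact h2

/-- **Bondy's theorem**: a strong digraph all of whose directed cycles have length at most `s` has
a proper colouring with `s` colours. -/
theorem exists_coloring_of_forall_cycle_le [Finite α] (hr : StrongOn r Set.univ) {s : ℕ}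
    (hs : 0 < s) (hcyc : ∀ x l, IsPath r x l x → l.length + 1 ≤ s) :
    ∃ c : α → Fin s, ∀ u v, u ≠ v → r u v → c u ≠ c v := by
  obtain ⟨w, hw, htight⟩ := exists_weight hr
  -- On a cycle this weight sums to its length minus `s` times its `w`-weight, at most `s - s`.
  have hpot : ∀ x l, IsPath r x l x → walkWeight (fun a b => 1 - (s : ℤ) * w a b) x l x ≤ 0 := by
    intro x l hl
    rw [walkWeight_one_sub_mul]
    have h1 := hw x l hl
    have h2 : ((l.length : ℤ) + 1) ≤ s := by exact_mod_cast hcyc x l hl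
    nlinarith
  obtain ⟨θ, hθ⟩ := exists_potential hpot
  have hwalk : ∀ (l : List α) x y, IsWalk r x l y →
      θ x + ((l.length + 1) - s * walkWeight w x l y) ≤ θ y := by
    intro l
    induction l with
    | nil => intro x y h; simpa using hθ x y h
    | cons a A ih =>
      intro x y h
      have h1 := hθ x a h.1
      have h2 := ih a y h.2
      rw [walkWeight_cons, List.length_cons]
      push_cast
      linarith
  have hs' : (0 : ℤ) < s := by exact_mod_cast hs
  refine ⟨fun v => ⟨(θ v % s).toNat, ?_⟩, fun u v huv hruv heq => ?_⟩
  · have := Int.emod_lt_of_pos (θ v) hs'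
    have := Int.emod_nonneg (θ v) hs'.ne'
    omega
  · have hmod : θ u % s = θ v % s := by
      have h1 := Int.emod_nonneg (θ u) hs'.ne'
      have h2 := Int.emod_nonneg (θ v) hs'.ne'
      have h3 := congrArg Fin.val heq
      simp only at h3
      omega
    -- The arc gives `θ v - θ u ≥ 1 - s * w u v`, and the return path gives `θ v - θ u ≤ s - s * w u
    -- v - (l.length + 1)`. So the difference lies strictly between consecutive multiples of `s`.
    obtain ⟨l, hl, hone⟩ := htight u v huv hruv
    obtain ⟨q, hq⟩ := Int.ModEq.dvd hmod
    have h1 := hθ u v hruv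
    have h2 := hwalk l v u hl.walk
    have h3 : walkWeight w v l u = 1 - w u v := by omega
    rw [h3] at h2
    have h4 : 0 < (s : ℤ) * (q + w u v) := by linarith
    have h5 : (s : ℤ) * (q + w u v - 1) < 0 := by linarith [Int.natCast_nonneg l.length]
    have h6 := pos_of_mul_pos_right h4 hs'.le
    have h7 := neg_of_mul_neg_right h5 hs'.le
    omega

end Dipath

/-! ### Good sets and gluing at one vertex. -/

namespace Dipath

variable {α : Type*} {r : α → α → Prop} {k : ℕ} {S S' : Set α}

/-- Vertex sets that behave, for the purpose of colouring, as long cycles of a digraph without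
`(k, 1; 1)`-spindle do. -/
structure Good (r : α → α → Prop) (k : ℕ) (S : Set α) : Prop where
  strongOn : StrongOn r S
  ear : ∀ u ∈ S, ∀ w ∈ S, u ≠ w → ∀ E, IsPath r u E w → (∀ z ∈ E, z ∉ S) →
    E.length + 1 < k ∧ ∃ B, IsPath r w B u ∧ (∀ z ∈ B, z ∈ S) ∧ k ≤ B.length + 2
  coloring : ∃ c : α → Fin (2 * k - 2), ∀ u ∈ S, ∀ w ∈ S, u ≠ w → r u w → c u ≠ c w

theorem good_singleton (hk : 3 ≤ k) (a : α) : Good r k {a} where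
  strongOn := by rintro x rfl y rfl h; exact absurd rfl h
  ear := by rintro x rfl y rfl h; exact absurd rfl h
  coloring := ⟨fun _ => ⟨0, by omega⟩, by rintro x rfl y rfl h; exact absurd rfl h⟩

/-- Two good sets with exactly one common vertex are not joined by further paths. -/
theorem Good.not_isPath_of_inter (hS : Good r k S) (hS' : Good r k S') {a u w : α} {E : List α}
    (ha : a ∈ S) (ha' : a ∈ S') (hinter : ∀ z ∈ S, z ∈ S' → z = a) (hu : u ∈ S) (hua : u ≠ a)
    (hw : w ∈ S') (hwa : w ≠ a) (hE : IsPath r u E w) (hES : ∀ z ∈ E, z ∉ S ∧ z ∉ S') : False := by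
  have huS' : u ∉ S' := fun h => hua (hinter u hu h)
  have hwS : w ∉ S := fun h => hwa (hinter w h hw)
  have huw : u ≠ w := fun h => huS' (h ▸ hw)
  -- Following `E` by `M` gives an ear of `S` from `u` to `a`, so `S` has a return path `B` from `a`
  -- to `u` of length at least `k - 1`. Then `B` followed by `E` is an ear of `S'` of length at
  -- least `k`, which is too long.
  obtain ⟨M, hM, hMS⟩ := hS'.strongOn w hw a ha' hwa
  have hear : IsPath r u (E ++ w :: M) a :=
    hE.append hM (fun h => huS' (hMS _ h)) (fun h => (hES _ h).1 ha) huw (Ne.symm hwa)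
      fun z hz hz' => (hES _ hz).2 (hMS _ hz')
  obtain ⟨-, B, hB, hBS, hlen⟩ := hS.ear u hu a ha hua _ hear (by
    intro z hz hzS
    rcases List.mem_append.1 hz with hz | hz
    · exact (hES _ hz).1 hzS
    · rcases List.mem_cons.1 hz with rfl | hz
      · exact hwS hzS
      · have := hinter z hzS (hMS _ hz)
        subst this
        exact hM.right_notMem hz)
  have hear' : IsPath r a (B ++ u :: E) w :=
    hB.append hE (fun h => (hES _ h).1 ha) (fun h => hwS (hBS _ h)) (Ne.symm hua) (Ne.symm huw)
      fun z hz hz' => (hES _ hz').1 (hBS _ hz)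
  obtain ⟨hlt, -⟩ := hS'.ear a ha' w hw (Ne.symm hwa) _ hear' (by
    intro z hz hzS
    rcases List.mem_append.1 hz with hz | hz
    · have := hinter z (hBS _ hz) hzS
      subst this
      exact hB.left_notMem hz
    · rcases List.mem_cons.1 hz with rfl | hz
      · exact huS' hzS
      · exact (hES _ hz).2 hzS)
  simp only [List.length_append, List.length_cons] at hlt
  omega

theorem StrongOn.union (hS : StrongOn r S) (hS' : StrongOn r S') {a : α}
    (ha : a ∈ S) (ha' : a ∈ S') (hinter : ∀ z ∈ S, z ∈ S' → z = a) : StrongOn r (S ∪ S') := by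
  have key : ∀ {T T' : Set α}, StrongOn r T → StrongOn r T' → a ∈ T → a ∈ T' →
      (∀ z ∈ T, z ∈ T' → z = a) → ∀ x ∈ T, ∀ y ∈ T', x ≠ y →
      ∃ l, IsPath r x l y ∧ ∀ z ∈ l, z ∈ T ∪ T' := by
    intro T T' hT hT' haT haT' hi x hx y hy hxy
    by_cases hxa : x = a
    · subst hxa
      obtain ⟨l, hl, hlT⟩ := hT' x haT' y hy hxy
      exact ⟨l, hl, fun z hz => Or.inr (hlT z hz)⟩
    by_cases hya : y = a
    · subst hya
      obtain ⟨l, hl, hlT⟩ := hT x hx y haT hxy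
      exact ⟨l, hl, fun z hz => Or.inl (hlT z hz)⟩
    obtain ⟨l, hl, hlT⟩ := hT x hx a haT hxa
    obtain ⟨l', hl', hlT'⟩ := hT' a haT' y hy (Ne.symm hya)
    refine ⟨l ++ a :: l', hl.append hl' (fun h => hxa (hi _ hx (hlT' _ h)))
      (fun h => hya (hi _ (hlT _ h) hy)) hxa hya ?_, ?_⟩
    · intro z hz hz'
      have := hi z (hlT _ hz) (hlT' _ hz')
      subst this
      exact hl.right_notMem hz
    · intro z hz
      rcases List.mem_append.1 hz with hz | hz
      · exact Or.inl (hlT _ hz)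
      · rcases List.mem_cons.1 hz with rfl | hz
        · exact Or.inl haT
        · exact Or.inr (hlT' _ hz)
  rintro x (hx | hx) y (hy | hy) hxy
  · obtain ⟨l, hl, hlS⟩ := hS x hx y hy hxy
    exact ⟨l, hl, fun z hz => Or.inl (hlS z hz)⟩
  · exact key hS hS' ha ha' hinter x hx y hy hxy
  · obtain ⟨l, hl, h⟩ := key hS' hS ha' ha (fun z h h' => hinter z h' h) x hx y hy hxy
    exact ⟨l, hl, fun z hz => (h z hz).symm⟩
  · obtain ⟨l, hl, hlS⟩ := hS' x hx y hy hxy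
    exact ⟨l, hl, fun z hz => Or.inr (hlS z hz)⟩

/-- By `Good.not_isPath_of_inter` an ear of the union has both ends in one of the two sets, and is
an ear of that set. Likewise no arc joins the two sets away from `a`, so the colourings combine once
a transposition of colours makes them agree at `a`. -/
theorem Good.union (hS : Good r k S) (hS' : Good r k S') {a : α}
    (ha : a ∈ S) (ha' : a ∈ S') (hinter : ∀ z ∈ S, z ∈ S' → z = a) : Good r k (S ∪ S') := by
  have hcross : ∀ {u w : α} {E : List α}, u ∈ S → w ∈ S' → u ≠ a → w ≠ a → IsPath r u E w →
      (∀ z ∈ E, z ∉ S ∪ S') → False := fun hu hw hua hwa hE hES =>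
    hS.not_isPath_of_inter hS' ha ha' hinter hu hua hw hwa hE
      fun z hz => not_or.1 (hES z hz)
  have hcross' : ∀ {u w : α} {E : List α}, u ∈ S' → w ∈ S → u ≠ a → w ≠ a → IsPath r u E w →
      (∀ z ∈ E, z ∉ S ∪ S') → False := fun hu hw hua hwa hE hES =>
    hS'.not_isPath_of_inter hS ha' ha (fun z h h' => hinter z h' h) hu hua hw hwa hE
      fun z hz => (not_or.1 (hES z hz)).symm
  refine ⟨hS.strongOn.union hS'.strongOn ha ha' hinter, ?_, ?_⟩
  · intro u hu w hw huw E hE hES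
    have h1 : u ∈ S → w ∈ S → E.length + 1 < k ∧
        ∃ B, IsPath r w B u ∧ (∀ z ∈ B, z ∈ S ∪ S') ∧ k ≤ B.length + 2 := by
      intro hu hw
      obtain ⟨hl, B, hB, hBS, hlen⟩ :=
        hS.ear u hu w hw huw E hE fun z hz h => hES z hz (Or.inl h)
      exact ⟨hl, B, hB, fun z hz => Or.inl (hBS z hz), hlen⟩
    have h2 : u ∈ S' → w ∈ S' → E.length + 1 < k ∧
        ∃ B, IsPath r w B u ∧ (∀ z ∈ B, z ∈ S ∪ S') ∧ k ≤ B.length + 2 := by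
      intro hu hw
      obtain ⟨hl, B, hB, hBS, hlen⟩ :=
        hS'.ear u hu w hw huw E hE fun z hz h => hES z hz (Or.inr h)
      exact ⟨hl, B, hB, fun z hz => Or.inr (hBS z hz), hlen⟩
    by_cases hua : u = a
    · subst hua
      rcases hw with hw | hw
      · exact h1 ha hw
      · exact h2 ha' hw
    by_cases hwa : w = a
    · subst hwa
      rcases hu with hu | hu
      · exact h1 hu ha
      · exact h2 hu ha'
    rcases hu with hu | hu <;> rcases hw with hw | hw
    · exact h1 hu hw
    · exact (hcross hu hw hua hwa hE hES).elim
    · exact (hcross' hu hw hua hwa hE hES).elim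
    · exact h2 hu hw
  · classical
    obtain ⟨c, hc⟩ := hS.coloring
    obtain ⟨c', hc'⟩ := hS'.coloring
    let σ := Equiv.swap (c a) (c' a)
    refine ⟨fun v => if v ∈ S then c v else σ (c' v), ?_⟩
    have hval : ∀ v ∈ S', (if v ∈ S then c v else σ (c' v)) = σ (c' v) := by
      intro v hv
      split_ifs with h
      · rw [hinter v h hv]
        exact (Equiv.swap_apply_right _ _).symm
      · rfl
    have h1 : ∀ u ∈ S, ∀ w ∈ S, u ≠ w → r u w →
        (if u ∈ S then c u else σ (c' u)) ≠ (if w ∈ S then c w else σ (c' w)) := by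
      intro u hu w hw huw h
      rw [if_pos hu, if_pos hw]
      exact hc u hu w hw huw h
    have h2 : ∀ u ∈ S', ∀ w ∈ S', u ≠ w → r u w →
        (if u ∈ S then c u else σ (c' u)) ≠ (if w ∈ S then c w else σ (c' w)) := by
      intro u hu w hw huw h
      rw [hval u hu, hval w hw]
      exact σ.injective.ne (hc' u hu w hw huw h)
    intro u hu w hw huw h
    by_cases hua : u = a
    · subst hua
      rcases hw with hw | hw
      · exact h1 _ ha _ hw huw h
      · exact h2 _ ha' _ hw huw h
    by_cases hwa : w = a
    · subst hwa
      rcases hu with hu | hu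
      · exact h1 _ hu _ ha huw h
      · exact h2 _ hu _ ha' huw h
    rcases hu with hu | hu <;> rcases hw with hw | hw
    · exact h1 _ hu _ hw huw h
    · exact (hcross hu hw hua hwa (isPath_of_rel h) (by simp)).elim
    · exact (hcross' hu hw hua hwa (isPath_of_rel h) (by simp)).elim
    · exact h2 _ hu _ hw huw h

/-! ### Long cycles are good. -/

/-- A path joining two vertices of a long cycle outside this cycle is short, and so is
the part of the cycle with the same ends. -/
theorem SpindleFree.ear_of_cycle (hr : SpindleFree r k) {u w : α} {A B E : List α}
    (hC : IsPath r u (A ++ w :: B) u) (hE : IsPath r u E w) (hEC : ∀ z ∈ E, z ∉ u :: (A ++ w :: B)) :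
    E.length + 1 < k ∧ A.length + 1 < k := by
  have huw : u ≠ w := by have := hC.left_notMem; grind
  have hEA : E.Disjoint A := fun z h h' => hEC z h (by simp [h'])
  have hEB : E.Disjoint B := fun z h h' => hEC z h (by simp [h'])
  have hAB : A.Disjoint B := by
    have := hC.nodup
    rw [List.nodup_append] at this
    intro z h h'
    exact this.2.2 z h z (by simp [h']) rfl
  -- Whichever of `E` and `A` has length at least `k` is the long path of a spindle, with the other
  -- as short path and `B` as way back.
  constructor <;> by_contra! hlen
  · exact hr u w E A B ⟨huw, hE, hC.left, hC.right, hlen, hEA, hEB, hAB⟩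
  · exact hr u w A E B ⟨huw, hC.left, hE, hC.right, hlen, hEA.symm, hAB, hEB⟩

/-- A cyclic sequence of length `n ≥ 2k` with values below `2k - 2` in which any `k` consecutive
terms are distinct, beginning with `0, …, k - 1`. -/
theorem exists_cyclic_sequence (hk : 3 ≤ k) (n : ℕ) (hn : 2 * k ≤ n) :
    ∃ c : ℕ → ℕ, (∀ i < k, c i = i) ∧ (∀ i < n, c i < 2 * k - 2) ∧
      ∀ i j, i < j → j < n → (j - i < k ∨ n - (j - i) < k) → c i ≠ c j := by
  induction n using Nat.strong_induction_on with
  | _ n ih =>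
    by_cases hbig : 3 * k ≤ n
    -- Prepend a block `0, …, k - 1`. The old sequence begins with the same block, so `k`
    -- consecutive terms across either seam remain distinct.
    · obtain ⟨c, h0, hc, hd⟩ := ih (n - k) (by omega) (by omega)
      refine ⟨fun i => if i < k then i else c (i - k), fun i hi => if_pos hi, ?_, ?_⟩
      · intro i hi
        dsimp only
        split_ifs
        · omega
        · exact hc _ (by omega)
      · intro i j hij hj hdist
        dsimp only
        split_ifs with hi hj' hj'
        · omega
        · by_cases hlt : j - i < k
          · rw [h0 (j - k) (by omega)]; omega
          · have := hd i (j - k) (by omega) (by omega) (by omega)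
            rwa [h0 i hi] at this
        · omega
        · exact hd _ _ (by omega) (by omega) (by omega)
    -- Two increasing blocks starting at `0`, of lengths `m` and `n - m` in `[k, 2k - 2]`; equal
    -- terms are then at cyclic distance at least `k`. The case `n = 3k - 1` needs `k ≥ 3`.
    · obtain ⟨m, hm1, hm2, hm3, hm4⟩ : ∃ m, k ≤ m ∧ m ≤ 2 * k - 2 ∧ k ≤ n - m ∧
          n - m ≤ 2 * k - 2 := by
        by_cases h : n ≤ 3 * k - 2
        · exact ⟨n - k, by omega, by omega, by omega, by omega⟩
        · exact ⟨2 * k - 2, by omega, by omega, by omega, by omega⟩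
      refine ⟨fun i => if i < m then i else i - m, fun i hi => if_pos (by omega), ?_, ?_⟩
      · intro i hi
        dsimp only
        split_ifs <;> omega
      · intro i j hij hj hdist
        dsimp only
        split_ifs <;> omega

end Dipath

namespace Dipath

variable {α : Type*} {r : α → α → Prop} {k : ℕ} {x : α} {l : List α}

/-- Indexed form of `IsPath.exists_split`, which also records the lengths of the two parts;
colouring by position needs them. -/
theorem IsPath.exists_split_getElem (h : IsPath r x l x) {i j : ℕ} (hij : i < j)
    (hj : j < (x :: l).length) :
    ∃ A B, IsPath r ((x :: l)[i]) (A ++ (x :: l)[j] :: B) ((x :: l)[i]) ∧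
      A.length + 1 = j - i ∧ B.length + 1 = (x :: l).length - (j - i) ∧
      ∀ z, z ∈ x :: l ↔ z ∈ (x :: l)[i] :: (A ++ (x :: l)[j] :: B) := by
  have key : ∃ l', IsPath r ((x :: l)[i]) l' ((x :: l)[i]) ∧
      l' = (x :: l).drop (i + 1) ++ (x :: l).take i := by
    cases i with
    | zero => exact ⟨l, by simpa using h, by simp⟩
    | succ i =>
      have hi : i < l.length := by simp only [List.length_cons] at hj; omega
      have e : l = l.take i ++ l[i] :: l.drop (i + 1) := by
        rw [← List.drop_eq_getElem_cons, List.take_append_drop]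
      have h' := h
      rw [e] at h'
      exact ⟨_, by simpa using h'.rotate, by simp⟩
  obtain ⟨l', hl', he⟩ := key
  have hlen : l'.length = l.length := by
    have hcons : (x :: l).length = l.length + 1 := rfl
    rw [he, List.length_append, List.length_drop, List.length_take]
    omega
  have hcons : (x :: l).length = l.length + 1 := rfl
  have hi : i < (x :: l).length := hij.trans hj
  have hm : j - i - 1 < l'.length := by omega
  have hget : l'[j - i - 1] = (x :: l)[j] := by
    simp only [he]
    rw [List.getElem_append_left (by rw [List.length_drop]; omega),
      List.getElem_drop]
    congr 1
    omega
  have e : l' = l'.take (j - i - 1) ++ (x :: l)[j] :: l'.drop (j - i - 1 + 1) := by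
    rw [← hget, ← List.drop_eq_getElem_cons, List.take_append_drop]
  refine ⟨l'.take (j - i - 1), l'.drop (j - i - 1 + 1), by rwa [← e], ?_, ?_, ?_⟩
  · rw [List.length_take]; omega
  · rw [List.length_drop]; omega
  · intro z
    rw [← e, he]
    have e2 : x :: l = (x :: l).take i ++ (x :: l)[i] :: (x :: l).drop (i + 1) := by
      rw [← List.drop_eq_getElem_cons, List.take_append_drop]
    conv_lhs => rw [e2]
    simp only [List.mem_append, List.mem_cons]
    tauto

/-- Without spindles, chords of a cycle span fewer than `k` of its arcs. -/
theorem SpindleFree.chord (hr : SpindleFree r k) (h : IsPath r x l x) {i j : ℕ} (hij : i < j)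
    (hj : j < (x :: l).length) :
    (r (x :: l)[i] (x :: l)[j] → j - i < k) ∧
      (r (x :: l)[j] (x :: l)[i] → (x :: l).length - (j - i) < k) := by
  obtain ⟨A, B, hC, hA, hB, -⟩ := h.exists_split_getElem hij hj
  refine ⟨fun hij => ?_, fun hji => ?_⟩
  · have := (hr.ear_of_cycle hC (isPath_of_rel hij) (by simp)).2
    omega
  · have := (hr.ear_of_cycle hC.rotate (isPath_of_rel hji) (by simp)).2
    omega

theorem isWalk_map_range {g : ℕ → α} {m : ℕ} (h : ∀ i ≤ m, r (g i) (g (i + 1))) :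
    IsWalk r (g 0) ((List.range m).map fun i => g (i + 1)) (g (m + 1)) := by
  induction m with
  | zero => simpa using h 0 le_rfl
  | succ m ih =>
    rw [List.range_succ, List.map_append]
    exact isWalk_append_cons.2 ⟨ih fun i hi => h i (by omega), h _ le_rfl⟩

/-- The circulant tournament on `2k - 1` vertices contains a spindle. -/
theorem SpindleFree.not_circulant (hr : SpindleFree r k) (hk : 3 ≤ k) {v : ℕ → α}
    (hinj : ∀ i < 2 * k - 1, ∀ j < 2 * k - 1, v i = v j → i = j)
    (hshort : ∀ i j, i < j → j < 2 * k - 1 → j - i < k → r (v i) (v j))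
    (hlong : ∀ i j, i < j → j < 2 * k - 1 → k ≤ j - i → r (v j) (v i)) : False := by
  -- The long path is `0, 2, 3, …, k - 1, k + 1, 1`, of length `k`; the short path is `0, 1` and the
  -- way back is `1, k, 0`. The index `k + 1` exists because `k ≥ 3`.
  let e : ℕ → ℕ := fun i => if i = 0 then 0 else if i ≤ k - 2 then i + 1
    else if i = k - 1 then k + 1 else 1
  have he0 : e 0 = 0 := rfl
  have he1 : e (k - 1 + 1) = 1 := by simp only [e]; split_ifs <;> first | contradiction | omega
  have hemem : ∀ i < k - 1, 2 ≤ e (i + 1) ∧ e (i + 1) ≤ k + 1 ∧ e (i + 1) ≠ k := by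
    intro i hi; simp only [e]; split_ifs <;> first | contradiction | omega
  have heinj : ∀ i < k - 1, ∀ j < k - 1, e (i + 1) = e (j + 1) → i = j := by
    intro i hi j hj; simp only [e]; split_ifs <;> first | contradiction | omega
  have hne : ∀ m < 2 * k - 1, (∀ i < k - 1, e (i + 1) ≠ m) →
      v m ∉ (List.range (k - 1)).map fun i => v (e (i + 1)) := by
    intro m hm hmi hmem
    obtain ⟨i, hi, hvi⟩ := List.mem_map.1 hmem
    have hi := List.mem_range.1 hi
    have := hemem i hi
    exact hmi i hi (hinj _ (by omega) _ hm hvi)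
  have hwalk : IsWalk r (v (e 0)) ((List.range (k - 1)).map fun i => v (e (i + 1)))
      (v (e (k - 1 + 1))) := by
    refine isWalk_map_range (g := fun i => v (e i)) fun i hi => ?_
    by_cases hik : i = k - 1
    · subst hik
      apply hlong <;> (simp only [e]; split_ifs <;> first | contradiction | omega)
    · apply hshort <;> (simp only [e]; split_ifs <;> first | contradiction | omega)
  rw [he0, he1] at hwalk
  have hk0 : v k ≠ v 0 := fun h => by have := hinj _ (by omega) _ (by omega) h; omega
  have hk1 : v k ≠ v 1 := fun h => by have := hinj _ (by omega) _ (by omega) h; omega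
  have h01 : v 0 ≠ v 1 := fun h => by have := hinj _ (by omega) _ (by omega) h; omega
  refine hr (v 0) (v 1) _ [] [v k] ⟨h01, ⟨hwalk, ?_, ?_, ?_⟩,
    isPath_of_rel (hshort _ _ (by omega) (by omega) (by omega)),
    ⟨⟨hshort 1 k (by omega) (by omega) (by omega), hlong 0 k (by omega) (by omega) (by omega)⟩,
      by simp, by simpa using hk1.symm, by simpa using hk0.symm⟩, ?_, by simp, ?_, by simp⟩
  · refine List.Nodup.map_on (fun i hi j hj hij => ?_) List.nodup_range
    have hi := List.mem_range.1 hi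
    have hj := List.mem_range.1 hj
    have := hemem i hi
    have := hemem j hj
    exact heinj i hi j hj (hinj _ (by omega) _ (by omega) hij)
  · exact hne 0 (by omega) fun i hi => by have := hemem i hi; omega
  · exact hne 1 (by omega) fun i hi => by have := hemem i hi; omega
  · simp only [List.length_map, List.length_range]; omega
  · rw [List.disjoint_singleton]
    exact hne k (by omega) fun i hi => by have := hemem i hi; omega

/-- The vertices of a long cycle can be coloured with `2k - 2` colours. -/
theorem SpindleFree.exists_coloring_cycle (hr : SpindleFree r k) (hk : 3 ≤ k)
    (h : IsPath r x l x) (hlen : 2 * k - 2 ≤ (x :: l).length) :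
    ∃ c : α → Fin (2 * k - 2), ∀ u ∈ x :: l, ∀ w ∈ x :: l, u ≠ w → r u w → c u ≠ c w := by
  classical
  obtain ⟨c, hc, hcr⟩ : ∃ c : ℕ → ℕ, (∀ i < (x :: l).length, c i < 2 * k - 2) ∧
      ∀ i j, ∀ hij : i < j, ∀ hj : j < (x :: l).length,
        (r (x :: l)[i] (x :: l)[j] ∨ r (x :: l)[j] (x :: l)[i]) → c i ≠ c j := by
    have hchord : ∀ i j, ∀ hij : i < j, ∀ hj : j < (x :: l).length,
        (r (x :: l)[i] (x :: l)[j] ∨ r (x :: l)[j] (x :: l)[i]) →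
        j - i < k ∨ (x :: l).length - (j - i) < k := by
      intro i j hij hj h'
      exact h'.imp (hr.chord h hij hj).1 (hr.chord h hij hj).2
    rcases (by omega : (x :: l).length = 2 * k - 2 ∨ (x :: l).length = 2 * k - 1 ∨
        2 * k ≤ (x :: l).length) with hn | hn | hn
    · exact ⟨id, fun i hi => by simp only [id]; omega, fun i j hij _ _ => hij.ne⟩
    · by_cases hnon : ∃ i j, ∃ hij : i < j, ∃ hj : j < (x :: l).length,
          ¬ (r (x :: l)[i] (x :: l)[j] ∨ r (x :: l)[j] (x :: l)[i])
      · obtain ⟨i, j, hij, hj, hnot⟩ := hnon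
        -- The nonadjacent positions `i` and `j` share the colour `i`; this frees `j` for the last
        -- position, whose own number `2k - 2` is out of range.
        refine ⟨fun m => if m = j then i else if m = 2 * k - 2 then j else m, ?_, ?_⟩
        · intro m hm
          dsimp only
          split_ifs <;> omega
        · intro a b hab hb hadj
          have hne : ¬ (a = i ∧ b = j) := by
            rintro ⟨rfl, rfl⟩
            exact hnot hadj
          dsimp only
          split_ifs <;> omega
      -- All pairs are adjacent, and the chord bound dictates each orientation, so the cycle spans
      -- the circulant tournament.
      · exfalso
        push Not at hnon
        refine hr.not_circulant hk (v := fun i => (x :: l).getD i x) ?_ ?_ ?_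
        · intro i hi j hj hij
          rw [List.getD_eq_getElem _ _ (by omega), List.getD_eq_getElem _ _ (by omega)] at hij
          exact (List.nodup_cons.2 ⟨h.left_notMem, h.nodup⟩).getElem_inj_iff.1 hij
        · intro i j hij hj hd
          rw [List.getD_eq_getElem _ _ (by omega), List.getD_eq_getElem _ _ (by omega)]
          refine (hnon i j hij (by omega)).resolve_right fun hji => ?_
          have := (hr.chord h hij (by omega)).2 hji
          omega
        · intro i j hij hj hd
          rw [List.getD_eq_getElem _ _ (by omega), List.getD_eq_getElem _ _ (by omega)]
          refine (hnon i j hij (by omega)).resolve_left fun hji => ?_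
          have := (hr.chord h hij (by omega)).1 hji
          omega
    · obtain ⟨c, -, hc, hd⟩ := exists_cyclic_sequence hk _ hn
      exact ⟨c, hc, fun i j hij hj h' => hd i j hij hj (hchord i j hij hj h')⟩
  refine ⟨fun a => if ha : a ∈ x :: l then
      ⟨c ((x :: l).idxOf a), hc _ (List.idxOf_lt_length_of_mem ha)⟩
    else ⟨0, by omega⟩, ?_⟩
  intro u hu w hw huw hadj
  dsimp only
  rw [dif_pos hu, dif_pos hw, Ne, Fin.mk.injEq]
  have hu' := List.idxOf_lt_length_of_mem hu
  have hw' := List.idxOf_lt_length_of_mem hw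
  rcases lt_trichotomy ((x :: l).idxOf u) ((x :: l).idxOf w) with hlt | heq | hlt
  · exact hcr _ _ hlt hw' (Or.inl (by rwa [List.getElem_idxOf hu', List.getElem_idxOf hw']))
  · exact absurd ((List.idxOf_inj hu).1 heq) huw
  · exact (hcr _ _ hlt hu' (Or.inr (by rwa [List.getElem_idxOf hu', List.getElem_idxOf hw']))).symm

/-- The vertex set of a long cycle is good. -/
theorem SpindleFree.good_cycle (hr : SpindleFree r k) (hk : 3 ≤ k)
    (h : IsPath r x l x) (hlen : 2 * k - 2 ≤ (x :: l).length) : Good r k {z | z ∈ x :: l} where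
  strongOn := by
    intro u hu w hw huw
    obtain ⟨A, B, hC, hp⟩ := h.exists_split hu hw huw
    exact ⟨A, hC.left, fun z hz => hp.mem_iff.2 (by simp [hz])⟩
  ear := by
    intro u hu w hw huw E hE hEC
    obtain ⟨A, B, hC, hp⟩ := h.exists_split hu hw huw
    obtain ⟨h1, h2⟩ := hr.ear_of_cycle hC hE fun z hz hz' => hEC z hz (hp.mem_iff.2 hz')
    refine ⟨h1, B, hC.right, fun z hz => hp.mem_iff.2 (by simp [hz]), ?_⟩
    -- The cycle has length at least `2k - 2` and the part through `A` at most `k - 1`, which leaves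
    -- at least `k - 1` for `B`.
    have := hp.length_eq
    simp only [List.length_cons, List.length_append] at this hlen
    omega
  coloring := hr.exists_coloring_cycle hk h hlen

end Dipath

/-! ### Quotients by good partitions and the product colouring. -/

namespace Dipath

variable {α β : Type*} {r : α → α → Prop} {k : ℕ}

/-- The arcs between distinct classes of the partition into the fibres of `f`. -/
def QuotRel (r : α → α → Prop) (f : α → β) (i j : β) : Prop :=
  i ≠ j ∧ ∃ u v, f u = i ∧ f v = j ∧ r u v

theorem reflTransGen_quotRel (f : α → β) {x y : α} (h : Relation.ReflTransGen r x y) :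
    Relation.ReflTransGen (QuotRel r f) (f x) (f y) := by
  induction h with
  | refl => exact .refl
  | @tail b c _ hbc ih =>
    by_cases hf : f b = f c
    · rwa [← hf]
    · exact ih.tail ⟨hf, b, c, rfl, rfl, hbc⟩

/-- A path of classes lifts to a path that visits every class in one segment. -/
theorem exists_lift {f : α → β} (hf : ∀ i, StrongOn r {v | f v = i}) {l : List β} {i j : β}
    (h : IsWalk (QuotRel r f) i l j) (hl : l.Nodup) :
    ∃ y L x, f y = i ∧ f x = j ∧ IsWalk r y L x ∧ L.Nodup ∧ (∀ z ∈ L, f z ∈ l) ∧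
      l.length ≤ L.length ∧ ∀ m ∈ l, ∃ A N B, L = A ++ (N ++ B) ∧ N ≠ [] ∧ (∀ z ∈ N, f z = m) ∧
        (∀ z ∈ A, f z ≠ m) ∧ (∀ z ∈ B, f z ≠ m) ∧ l.length ≤ A.length + B.length + 1 := by
  induction l generalizing i with
  | nil =>
    obtain ⟨-, u, v, hu, hv, huv⟩ := h
    exact ⟨u, [], v, hu, hv, huv, by simp, by simp, by simp, by simp⟩
  | cons m l ih =>
    obtain ⟨⟨-, u, x₁, hu, hx₁, hux₁⟩, hw⟩ := h
    obtain ⟨hml, hl⟩ := List.nodup_cons.1 hl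
    obtain ⟨y₁, L, x, hy₁, hx, hL, hLn, hLl, hlen, hseg⟩ := ih hw hl
    -- `N` runs inside the class `m` from the entry vertex `x₁` to the exit vertex `y₁`.
    obtain ⟨N, hN, hNn, hNm, hNL⟩ : ∃ N : List α, N ≠ [] ∧ N.Nodup ∧ (∀ z ∈ N, f z = m) ∧
        IsWalk r u (N ++ L) x := by
      by_cases hxy : x₁ = y₁
      · subst hxy
        exact ⟨[x₁], by simp, by simp, by simpa using hx₁, hux₁, hL⟩
      · obtain ⟨P, hP, hPm⟩ := hf m x₁ hx₁ y₁ hy₁ hxy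
        refine ⟨x₁ :: (P ++ [y₁]), by simp, ?_, ?_, ?_⟩
        · have := hP.nodup
          have := hP.left_notMem
          have := hP.right_notMem
          grind
        · intro z hz
          simp only [List.mem_cons, List.mem_append, List.not_mem_nil, or_false] at hz
          rcases hz with rfl | hz | rfl
          · exact hx₁
          · exact hPm z hz
          · exact hy₁
        · simp only [List.cons_append, List.append_assoc, List.nil_append]
          exact ⟨hux₁, isWalk_append_cons.2 ⟨hP.walk, hL⟩⟩
    have hLm : ∀ z ∈ L, f z ≠ m := fun z hz h => hml (h ▸ hLl z hz)
    have hNpos : 0 < N.length := List.length_pos_iff.2 hN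
    refine ⟨u, N ++ L, x, hu, hx, hNL, ?_, ?_, ?_, ?_⟩
    · rw [List.nodup_append]
      refine ⟨hNn, hLn, ?_⟩
      rintro a ha b hb rfl
      exact hLm a hb (hNm a ha)
    · intro z hz
      rcases List.mem_append.1 hz with hz | hz
      · rw [hNm z hz]; exact List.mem_cons_self
      · exact List.mem_cons_of_mem _ (hLl z hz)
    · rw [List.length_cons, List.length_append]; omega
    · intro m' hm'
      rcases List.mem_cons.1 hm' with rfl | hm'
      · exact ⟨[], N, L, rfl, hN, hNm, by simp, hLm, by simpa using hlen⟩
      · obtain ⟨A, N', B, rfl, hN', h1, h2, h3, h4⟩ := hseg m' hm'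
        refine ⟨N ++ A, N', B, by simp, hN', h1, ?_, h3, ?_⟩
        · intro z hz
          rcases List.mem_append.1 hz with hz | hz
          · rw [hNm z hz]; rintro rfl; exact hml hm'
          · exact h2 z hz
        · rw [List.length_cons, List.length_append]; omega

/-- A long cycle of good classes lifts to a cycle with one vertex in each of these classes. -/
theorem exists_lift_cycle (hk : 3 ≤ k) {f : α → β} (hf : ∀ i, Good r k {v | f v = i})
    {l : List β} {i : β} (h : IsPath (QuotRel r f) i l i) (hlen : 2 * k - 2 ≤ l.length + 1) :
    ∃ x L, IsPath r x L x ∧ l.length ≤ L.length ∧ Set.InjOn f {z | z ∈ x :: L} := by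
  obtain ⟨y, L, x, hy, hx, hL, hLn, hLl, hLlen, hseg⟩ :=
    exists_lift (fun i => (hf i).strongOn) h.walk h.nodup
  have hLi : ∀ z ∈ L, f z ≠ i := fun z hz hzi => h.left_notMem (hzi ▸ hLl z hz)
  -- Otherwise `L` is an ear of the class `i` of length at least `2k - 2 ≥ k`.
  have hyx : y = x := by
    by_contra hne
    have := ((hf i).ear y hy x hx hne L
      ⟨hL, hLn, fun hm => hLi _ hm hy, fun hm => hLi _ hm hx⟩ hLi).1
    omega
  subst hyx
  have hC : IsPath r y L y := ⟨hL, hLn, fun hm => hLi _ hm hy, fun hm => hLi _ hm hx⟩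
  have hinj : ∀ z ∈ L, ∀ z' ∈ L, f z = f z' → z = z' := by
    intro z hz z' hz' heq
    obtain ⟨A, N, B, hABN, hN, hNm, hA, hB, hcount⟩ := hseg _ (hLl z hz)
    have hmem : ∀ w ∈ L, f w = f z → w ∈ N := by
      intro w hw hwz
      rw [hABN, List.mem_append, List.mem_append] at hw
      rcases hw with hw | hw | hw
      · exact absurd hwz (hA w hw)
      · exact hw
      · exact absurd hwz (hB w hw)
    have hzN := hmem z hz rfl
    have hzN' := hmem z' hz' heq.symm
    obtain ⟨a, N', rfl⟩ := List.exists_cons_of_ne_nil hN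
    rcases List.eq_nil_or_concat' N' with rfl | ⟨N'', b, rfl⟩
    · rw [List.mem_singleton] at hzN hzN'
      rw [hzN, hzN']
    · exfalso
      -- If the segment in the class has distinct ends `a` and `b`, the rest of the cycle is an ear
      -- from `b` to `a`; it meets every other class, so its length is at least `2k - 2 ≥ k`.
      have hrot : IsPath r b ((B ++ y :: A) ++ a :: N'') b := by
        have e : L = (A ++ a :: N'') ++ b :: B := by rw [hABN]; simp
        rw [e] at hC
        simpa using hC.rotate
      have hba : b ≠ a := by
        have := hrot.left_notMem
        grind
      have := ((hf (f z)).ear b (hNm b (by simp)) a (hNm a (by simp)) hba _ hrot.left (by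
        intro w hw hwz
        rcases List.mem_append.1 hw with hw | hw
        · exact hB w hw hwz
        · rcases List.mem_cons.1 hw with rfl | hw
          · exact hLi z hz (Eq.trans (Eq.symm hwz) hy)
          · exact hA w hw hwz)).1
      simp only [List.length_append, List.length_cons] at this
      omega
  refine ⟨y, L, hC, hLlen, ?_⟩
  intro z hz z' hz' heq
  rcases List.mem_cons.1 hz with rfl | h₁ <;> rcases List.mem_cons.1 hz' with rfl | h₂
  · rfl
  · exact absurd (heq.symm.trans hy) (hLi _ h₂)
  · exact absurd (heq.trans hy) (hLi _ h₁)
  · exact hinj z h₁ z' h₂ heq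

/-- Good classes met exactly once by a long cycle unite, with the cycle, to a good set. -/
theorem Good.iUnion_cycle {f : α → β} (hf : ∀ i, Good r k {v | f v = i}) {C : Set α}
    (hC : Good r k C) (hinj : Set.InjOn f C) (Z : List α) (hZ : Z.Nodup) (hZC : ∀ z ∈ Z, z ∈ C) :
    Good r k (C ∪ {v | ∃ z ∈ Z, f v = f z}) := by
  induction Z with
  | nil => simpa using hC
  | cons a Z ih =>
    obtain ⟨haZ, hZ⟩ := List.nodup_cons.1 hZ
    have haC := hZC a List.mem_cons_self
    have h := ih hZ fun z hz => hZC z (List.mem_cons_of_mem _ hz)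
    have e : C ∪ {v | ∃ z ∈ a :: Z, f v = f z} =
        (C ∪ {v | ∃ z ∈ Z, f v = f z}) ∪ {v | f v = f a} := by
      ext v
      simp only [List.mem_cons, Set.mem_union, Set.mem_ofPred_eq, exists_eq_or_imp]
      rw [or_assoc, or_comm (a := f v = f a)]
    rw [e]
    -- The fibre of `a` meets `C` only in `a`, and none of the fibres already added.
    refine h.union (hf (f a)) (Or.inl haC) rfl ?_
    rintro z (hz | ⟨w, hw, hzw⟩) hza
    · exact hinj hz haC hza
    · have := hinj (hZC w (List.mem_cons_of_mem _ hw)) haC (hzw.symm.trans hza)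
      exact absurd (this ▸ hw) haZ

/-- Merging classes leaves empty fibres, which must count as good. -/
theorem good_empty (hk : 3 ≤ k) : Good r k ∅ where
  strongOn := by rintro x ⟨⟩
  ear := by rintro x ⟨⟩
  coloring := ⟨fun _ => ⟨0, by omega⟩, by rintro x ⟨⟩⟩

/-- A finite strong digraph without spindle is partitioned into good sets in such a way that
the quotient has no long cycle. -/
theorem SpindleFree.exists_good_partition [Finite α] (hr : SpindleFree r k) (hk : 3 ≤ k) :
    ∃ f : α → α, (∀ i, Good r k {v | f v = i}) ∧
      ∀ i l, IsPath (QuotRel r f) i l i → l.length + 1 ≤ 2 * k - 3 := by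
  classical
  have hne : {f : α → α | ∀ i, Good r k {v | f v = i}}.Nonempty :=
    ⟨id, fun i => by simpa using good_singleton hk i⟩
  -- A good partition with the fewest nonempty classes.
  obtain ⟨f, hf, hmin⟩ := (measure fun f : α → α => (Set.range f).ncard).wf.has_min _ hne
  refine ⟨f, hf, fun i l hl => ?_⟩
  by_contra hlen
  obtain ⟨x, L, hC, hLlen, hinj⟩ := exists_lift_cycle hk hf hl (by omega)
  have hgood := Good.iUnion_cycle hf (hr.good_cycle hk hC (by rw [List.length_cons]; omega)) hinj
    (x :: L) (List.nodup_cons.2 ⟨hC.left_notMem, hC.nodup⟩) fun z hz => hz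
  -- Merge all classes that the cycle meets into the class of `x`; the value `f z` of another cycle
  -- vertex `z` then leaves the range.
  let g : α → α := fun v => if ∃ z ∈ x :: L, f v = f z then f x else f v
  have hx : x ∈ x :: L := List.mem_cons_self
  refine hmin g (fun i => ?_) ?_
  · by_cases hi : i = f x
    · convert hgood using 1
      ext v
      simp only [Set.mem_ofPred_eq, Set.mem_union, g, hi]
      split_ifs with h
      · exact iff_of_true rfl (Or.inr h)
      · refine ⟨fun hv => absurd ⟨x, hx, hv⟩ h, ?_⟩
        rintro (hv | hv)
        · exact absurd ⟨v, hv, rfl⟩ h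
        · exact absurd hv h
    · by_cases hi' : ∃ z ∈ x :: L, i = f z
      · convert good_empty (r := r) hk using 1
        ext v
        simp only [Set.mem_ofPred_eq, Set.mem_empty_iff_false, iff_false, g]
        split_ifs with h
        · exact fun h => hi h.symm
        · rintro rfl; exact h hi'
      · convert hf i using 1
        ext v
        simp only [Set.mem_ofPred_eq, g]
        split_ifs with h
        · refine ⟨fun h => absurd h.symm hi, ?_⟩
          rintro rfl
          exact absurd h hi'
        · rfl
  · have hLpos : L ≠ [] := by
      rintro rfl
      simp only [List.length_nil] at hLlen
      omega
    obtain ⟨z, hz⟩ := List.exists_mem_of_ne_nil L hLpos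
    refine Set.ncard_lt_ncard ⟨?_, fun hsub => ?_⟩ (Set.toFinite _)
    · rintro _ ⟨v, rfl⟩
      simp only [g]
      split_ifs
      · exact ⟨x, rfl⟩
      · exact ⟨v, rfl⟩
    · obtain ⟨v, hv⟩ := hsub ⟨z, rfl⟩
      simp only [g] at hv
      have hzC : z ∈ x :: L := List.mem_cons_of_mem _ hz
      split_ifs at hv with h
      · have := hinj hx hzC hv
        subst this
        exact hC.left_notMem hz
      · exact h ⟨z, hzC, hv⟩

/-- A finite strong digraph without spindle has a colouring with few colours. -/
theorem SpindleFree.exists_coloring [Finite α] (hr : SpindleFree r k) (hk : 3 ≤ k)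
    (hstrong : ∀ x y, Relation.ReflTransGen r x y) :
    ∃ c : α → Fin ((2 * k - 2) * (2 * k - 3)), ∀ u v, u ≠ v → r u v → c u ≠ c v := by
  obtain ⟨f, hf, hcyc⟩ := hr.exists_good_partition hk
  -- Only nonempty classes are kept, since values outside the range would destroy strong
  -- connectivity of the quotient.
  let F : α → Set.range f := Set.rangeFactorization f
  have hq : ∀ i j, QuotRel r F i j → QuotRel r f i j := by
    rintro i j ⟨hne, u, v, rfl, rfl, huv⟩
    exact ⟨fun h => hne (Subtype.ext h), u, v, rfl, rfl, huv⟩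
  obtain ⟨d, hd⟩ := exists_coloring_of_forall_cycle_le (r := QuotRel r F) (s := 2 * k - 3) (by
      rintro ⟨_, x, rfl⟩ - ⟨_, y, rfl⟩ - hne
      obtain ⟨l, hl⟩ := exists_isPath_of_reflTransGen
        (reflTransGen_quotRel F (hstrong x y)) hne
      exact ⟨l, hl, fun _ _ => trivial⟩) (by omega) (by
      intro x l hl
      simpa using hcyc _ _ (hl.map Subtype.val_injective hq))
  choose c hc using fun i => (hf i).coloring
  refine ⟨fun v => finProdFinEquiv (c (f v) v, d (F v)), fun u v huv hruv heq => ?_⟩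
  have heq := Prod.ext_iff.1 (finProdFinEquiv.injective heq)
  by_cases hfuv : f u = f v
  · have h1 := heq.1
    simp only [hfuv] at h1
    exact hc (f v) u hfuv v rfl huv hruv h1
  · have hF : F u ≠ F v := fun h => hfuv (congrArg Subtype.val h)
    exact hd _ _ hF ⟨hF, u, v, rfl, rfl, hruv⟩ heq.2

/-! ### Reduction to finite digraphs and conclusion. -/

theorem IsWalk.reflTransGen_subtype {T : Set α} {x y : α} {l : List α} (h : IsWalk r x l y)
    (hx : x ∈ T) (hl : ∀ z ∈ l, z ∈ T) (hy : y ∈ T) :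
    Relation.ReflTransGen (fun a b : T => r a b) ⟨x, hx⟩ ⟨y, hy⟩ := by
  induction l generalizing x with
  | nil => exact .single h
  | cons m l ih =>
    exact .head (b := ⟨m, hl m List.mem_cons_self⟩) h.1
      (ih h.2 _ fun z hz => hl z (List.mem_cons_of_mem _ hz))

/-- Every finite set of vertices of a strong digraph lies in a finite strong subdigraph. -/
theorem exists_finite_strong_superset (hstrong : ∀ x y, Relation.ReflTransGen r x y) {S : Set α}
    (hS : S.Finite) : ∃ T : Set α, T.Finite ∧ S ⊆ T ∧
      ∀ x y : T, Relation.ReflTransGen (fun a b : T => r a b) x y := by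
  have hpath : ∀ x y, ∃ l, x ≠ y → IsPath r x l y := by
    intro x y
    by_cases hxy : x = y
    · exact ⟨[], fun h => absurd hxy h⟩
    · obtain ⟨l, hl⟩ := exists_isPath_of_reflTransGen (hstrong x y) hxy
      exact ⟨l, fun _ => hl⟩
  choose P hP using hpath
  let T : Set α := S ∪ ⋃ x ∈ S, ⋃ y ∈ S, {z | x ≠ y ∧ z ∈ P x y}
  have hST : S ⊆ T := Set.subset_union_left
  have hPT : ∀ x ∈ S, ∀ y ∈ S, x ≠ y → ∀ z ∈ P x y, z ∈ T := fun x hx y hy hne z hz =>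
    Or.inr (Set.mem_biUnion hx (Set.mem_biUnion hy ⟨hne, hz⟩))
  have hSS : ∀ x (hx : x ∈ S) y (hy : y ∈ S),
      Relation.ReflTransGen (fun a b : T => r a b) ⟨x, hST hx⟩ ⟨y, hST hy⟩ := by
    intro x hx y hy
    by_cases hxy : x = y
    · subst hxy; exact .refl
    · exact (hP x y hxy).walk.reflTransGen_subtype _ (hPT x hx y hy hxy) _
  -- A vertex added on a chosen path is reached from the start of that path and reaches its end,
  -- within `T`.
  have hend : ∀ z : T, (∃ x, ∃ hx : x ∈ S,
      Relation.ReflTransGen (fun a b : T => r a b) ⟨x, hST hx⟩ z) ∧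
      ∃ y, ∃ hy : y ∈ S, Relation.ReflTransGen (fun a b : T => r a b) z ⟨y, hST hy⟩ := by
    rintro ⟨z, hz⟩
    by_cases hzS : z ∈ S
    · exact ⟨⟨z, hzS, .refl⟩, ⟨z, hzS, .refl⟩⟩
    · have hz' := hz.resolve_left hzS
      simp only [Set.mem_iUnion, Set.mem_ofPred_eq] at hz'
      obtain ⟨x, hx, y, hy, hxy, hmem⟩ := hz'
      have hw := (hP x y hxy).walk
      have hT := hPT x hx y hy hxy
      obtain ⟨A, B, e⟩ := List.append_of_mem hmem
      rw [e] at hw hT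
      rw [isWalk_append_cons] at hw
      exact ⟨⟨x, hx, hw.1.reflTransGen_subtype _ (fun w hw => hT w (by simp [hw])) _⟩,
        ⟨y, hy, hw.2.reflTransGen_subtype _ (fun w hw => hT w (by simp [hw])) _⟩⟩
  refine ⟨T, ?_, hST, fun x y => ?_⟩
  · refine hS.union (hS.biUnion fun x _ => hS.biUnion fun y _ => ?_)
    exact (P x y).finite_toSet.subset fun z hz => hz.2
  · obtain ⟨-, x', hx', h1⟩ := hend x
    obtain ⟨⟨y', hy', h2⟩, -⟩ := hend y
    exact (h1.trans (hSS x' hx' y' hy')).trans h2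

end Dipath

theorem theorem3 {V : Type*} (k : ℕ) (hk : 3 ≤ k) (D : Digraph V) (hD : D.IsStrong)
    (hχ : (((2 * k - 2) * (2 * k - 3) : ℕ) : ℕ∞) < D.chromaticNumber) :
    D.ContainsSubdivision (Digraph.bispindle k) := by
  by_contra hcon
  have hfree : Dipath.SpindleFree D.Adj k := fun x y P Q R h => hcon (h.containsSubdivision hk)
  refine absurd hχ (not_lt.2 ?_)
  refine SimpleGraph.Colorable.chromaticNumber_le ?_
  -- De Bruijn–Erdős compactness: it suffices to colour finite subgraphs, each of which sits in a
  -- finite strong subdigraph.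
  refine SimpleGraph.nonempty_hom_of_forall_finite_subgraph_hom fun G' hG' => ?_
  refine Classical.choice ?_
  obtain ⟨T, hT, hGT, hstrong⟩ := Dipath.exists_finite_strong_superset hD hG'
  have := hT.to_subtype
  have hfreeT : Dipath.SpindleFree (fun a b : T => D.Adj a b) k := fun x y P Q R h =>
    hfree _ _ _ _ _ (h.map Subtype.val_injective fun _ _ h => h)
  obtain ⟨c, hc⟩ := hfreeT.exists_coloring hk hstrong
  refine ⟨⟨fun v => c ⟨v, hGT v.2⟩, fun {u v} huv => ?_⟩⟩
  have hadj := (SimpleGraph.fromRel_adj D.Adj (u : V) (v : V)).1 (G'.adj_sub huv)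
  have hne : (⟨u, hGT u.2⟩ : T) ≠ ⟨v, hGT v.2⟩ := fun h => hadj.1 (Subtype.mk.inj h)
  rw [SimpleGraph.top_adj]
  rcases hadj.2 with h | h
  · exact hc _ _ hne h
  · exact (hc _ _ hne.symm h).symm
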